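/- Let $f_1,\dots,f_k$ be non-zero Laurent polynomials with complex coefficients in $t=(t_1,\dots,t_n)$. Assume that for each $i$ all non-vanishing coefficients of $f_i$ lie in an open, strongly convex polyhedral cone $U_i\subset\mathbb{C}=\mathbb{R}^2$, i.e. the interior of a finitely generated convex cone that contains no line. Then $f_i(t)\in U_i$ for every $t\in(0,\infty)^n$, and $f_i(t)^{-c}=e^{-c\log f_i(t)}$ is defined by any fixed continuous branch of $\log$ on $U_i$. For $s\in\mathbb{C}^n$ and $c\in\mathbb{C}^k$ consider the Mellin transform $$\mathcal{M}(f_i,s,c)=\int_{(0,\infty)^n}t^{s}\prod_{i=1}^k f_i(t)^{-c_i}\,\frac{dt_1}{t_1}\cdots\frac{dt_n}{t_n},\qquad t^s=\prod_{j=1}^n t_j^{s_j}.$$ For a Laurent polynomial $h$ let $P(h)\subset\mathbb{R}^n$ be its Newton polytope, i.e. the convex hull of the exponents $m\in\mathbb{Z}^n$ of its non-vanishing coefficients, and for $u\in\mathbb{R}^n$ put $d_u(h)=\min_{m\in P(h)}\langle m,u\rangle$. Let $P=P(f_1\cdots f_k)$, and let $\Sigma_P$ be its normal fan, which consists of the cones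 $\sigma_Q=\{u\in\mathbb{R}^n : \langle\cdot,u\rangle \text{ attains its minimum over } P \text{ at every point of } Q\}$, one for each non-empty face $Q$ of $P$. For a ray (one-dimensional cone) $\rho\in\Sigma_P(1)$ let $u_\rho\in\mathbb{Z}^n$ be its lattice generator, i.e. the generator of the semigroup $\rho\cap\mathbb{Z}^n$, and put $d_\rho(c)=\sum_{i=1}^k c_i\,d_{u_\rho}(f_i)$. Let $$\Lambda(f_i)=\{(s,c)\in\mathbb{C}^n\times\mathbb{C}^k : \operatorname{Re}\langle s,u_\rho\rangle>\operatorname{Re} d_\rho(c)\ \text{ for all } \rho\in\Sigma_P(1)\}.$$ If $P$ is full-dimensional (its affine span is $\mathbb{R}^n$), then $\Lambda(f_i)$ is non-empty, and for every $(s,c)\in\mathbb{C}^n\times\mathbb{C}^k$ the integral $\mathcal{M}(f_i,s,c)$ converges absolutely if and only if $(s,c)\in\Lambda(f_i)$. If $P$ is not full-dimensional, then $\mathcal{M}(f_i,s,c)$ is absolutely convergent for no $(s,c)\in\mathbb{C}^n\times\mathbb{C}^k$. -/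

import Mathlib

open MeasureTheory

namespace MellinTransform

noncomputable section

/-- Laurent polynomials over `ℂ` in `n` variables, `∑ a_m t^m` with exponents `m ∈ M = ℤⁿ`. -/
abbrev LaurentPoly (n : ℕ) : Type := AddMonoidAlgebra ℂ (Fin n → ℤ)

/-- The inclusion of the lattice `ℤⁿ` in `ℝⁿ`, used for `M ⊆ M_ℝ` and for `N ⊆ N_ℝ`. -/
def toReal {n : ℕ} (m : Fin n → ℤ) : Fin n → ℝ := fun j => (m j : ℝ)

/-- The set of exponents of the non-vanishing coefficients of a Laurent polynomial. -/
def exponents {n : ℕ} (h : LaurentPoly n) : Finset (Fin n → ℤ) := h.coeff.support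

/-- The value `h(t) = ∑ a_m t^m` at a real point `t` (with non-vanishing coordinates). -/
def evalAt {n : ℕ} (h : LaurentPoly n) (t : Fin n → ℝ) : ℂ :=
  ∑ m ∈ exponents h, h.coeff m * ∏ j, (t j : ℂ) ^ (m j)

/-- The Newton polytope `P(h)`: the convex hull of the exponents of `h`. -/
def newtonPolytope {n : ℕ} (h : LaurentPoly n) : Set (Fin n → ℝ) :=
  convexHull ℝ (toReal '' (exponents h : Set (Fin n → ℤ)))

/-- A polytope in `ℝⁿ` is full-dimensional if its affine span is the whole space. -/
def IsFullDimensional {n : ℕ} (P : Set (Fin n → ℝ)) : Prop := affineSpan ℝ P = ⊤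

/-- The face `F_u P` of `P` on which the weight vector `u` is minimal. -/
def face {n : ℕ} (P : Set (Fin n → ℝ)) (u : Fin n → ℝ) : Set (Fin n → ℝ) :=
  {p ∈ P | ∀ q ∈ P, p ⬝ᵥ u ≤ q ⬝ᵥ u}

/-- The cone `σ_Q` of the inner normal vectors of a face `Q` of `P`: all weight vectors `u` whose
minimum over `P` is attained on all of `Q`. -/
def normalCone {n : ℕ} (P Q : Set (Fin n → ℝ)) : Set (Fin n → ℝ) :=
  {u | Q ⊆ face P u}

/-- The normal fan `Σ_P` of a polytope `P`: the cones `σ_Q`, where `Q` runs through the faces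
of `P` (including `P` itself, which is the face of the weight vector `0`). -/
def normalFan {n : ℕ} (P : Set (Fin n → ℝ)) : Set (Set (Fin n → ℝ)) :=
  {σ | ∃ u : Fin n → ℝ, σ = normalCone P (face P u)}

/-- The rays `Σ_P(1)`: the one-dimensional cones of the normal fan. -/
def rays {n : ℕ} (P : Set (Fin n → ℝ)) : Set (Set (Fin n → ℝ)) :=
  {ρ ∈ normalFan P | Module.finrank ℝ (Submodule.span ℝ ρ) = 1}

/-- `u ∈ N = ℤⁿ` is the lattice generator `u_ρ` of the rational ray `ρ`: the ray is `ℝ_{≥0} u`,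
and every lattice point on it is a multiple of `u` by a natural number. -/
def IsLatticeGenerator {n : ℕ} (ρ : Set (Fin n → ℝ)) (u : Fin n → ℤ) : Prop :=
  ρ = {x | ∃ r : ℝ, 0 ≤ r ∧ x = r • toReal u} ∧
    ∀ v : Fin n → ℤ, toReal v ∈ ρ → ∃ j : ℕ, v = j • u

/-- `d_u(h) = min_{m ∈ P(h)} ⟨m, u⟩`; for `h ≠ 0` the infimum is a minimum. -/
def weight {n : ℕ} (u : Fin n → ℝ) (h : LaurentPoly n) : ℝ :=
  sInf ((fun m => m ⬝ᵥ u) '' newtonPolytope h)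

/-- `d_u(c) = ∑ i, c_i d_u(f_i)` for a complex vector `c`. -/
def weightSum {n k : ℕ} (f : Fin k → LaurentPoly n) (u : Fin n → ℝ) (c : Fin k → ℂ) : ℂ :=
  ∑ i, c i * (weight u (f i) : ℂ)

/-- The region `Λ(f_i) ⊆ M_ℂ × ℂᵏ` of all `(s, c)` with `Re ⟨s, u_ρ⟩ > Re d_ρ(c)` for every ray `ρ`
of the normal fan of the Newton polytope of `f_1 ⋯ f_k`, with lattice generator `u_ρ`. -/
def convergenceRegion {n k : ℕ} (f : Fin k → LaurentPoly n) :
    Set ((Fin n → ℂ) × (Fin k → ℂ)) :=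
  {x | ∀ ρ ∈ rays (newtonPolytope (∏ i, f i)), ∀ u : Fin n → ℤ, IsLatticeGenerator ρ u →
    (weightSum f (toReal u) x.2).re < (∑ j, x.1 j * (u j : ℂ)).re}

/-- An open strongly convex polyhedral cone in `ℂ = ℝ²`: the interior of a finitely generated
convex cone that contains no line. -/
def IsOpenStronglyConvexCone (U : Set ℂ) : Prop :=
  ∃ σ : PointedCone ℝ ℂ, σ.FG ∧ (σ : ConvexCone ℝ ℂ).Salient ∧ U = interior (σ : Set ℂ)

/-- `L` is (on `U`) a continuous branch of the complex logarithm. -/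
def IsLogBranch (L : ℂ → ℂ) (U : Set ℂ) : Prop :=
  ContinuousOn L U ∧ ∀ w ∈ U, Complex.exp (L w) = w

/-- The integrand `t^s ∏ f_i(t)^{-c_i} / (t_1 ⋯ t_n)` of the Mellin transform with respect to the
Lebesgue measure `dt_1 ⋯ dt_n`, where `w^a = exp (a * L_i w)` for the chosen branch `L_i`. -/
def mellinIntegrand {n k : ℕ} (f : Fin k → LaurentPoly n) (L : Fin k → ℂ → ℂ)
    (s : Fin n → ℂ) (c : Fin k → ℂ) (t : Fin n → ℝ) : ℂ :=
  (∏ j, (t j : ℂ) ^ (s j)) * (∏ i, Complex.exp (-c i * L i (evalAt (f i) t))) *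
    ∏ j, (t j : ℂ)⁻¹

/-- The Mellin transform `∫ t^s ∏ f_i(t)^{-c_i} dt/t` over `(0, ∞)ⁿ` converges absolutely. -/
def MellinConverges {n k : ℕ} (f : Fin k → LaurentPoly n) (L : Fin k → ℂ → ℂ)
    (s : Fin n → ℂ) (c : Fin k → ℂ) : Prop :=
  IntegrableOn (mellinIntegrand f L s c) {t | ∀ j, 0 < t j} volume

end

end MellinTransform

/-!
In the coordinates `t = exp (-u)`, `u ∈ ℝⁿ`, the Mellin transform becomes an integral over `ℝⁿ`.
The coefficients of `f i` lie in an open half-plane, so the terms of `f i (exp (-u))` cannot cancel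
and `‖f i (exp (-u))‖` agrees with its largest term `exp (-d_u(f i))` up to a bounded factor
(`exists_abs_log_norm_evalAt_add_weight_le`). A branch of the logarithm on a cone in a half-plane
has bounded imaginary part (`IsOpenStronglyConvexCone.exists_abs_im_le`), so the imaginary parts of
the `c i` contribute only a bounded factor. Hence the integrand has the size `exp (-φ u)` with
`φ u = ⟨Re s, u⟩ - ∑ i, Re (c i) * d_u(f i)`; this is `decay`.

The function `φ` is Lipschitz and positively homogeneous. For such a function `exp (-φ)` is
integrable if and only if `φ` is positive away from the origin (`integrable_exp_neg_iff`): a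
positive `φ` dominates a multiple of the norm, and a `φ` that is not positive at some `u ≠ 0` is
bounded above on a tube of infinite volume around the ray through `u`. Thus absolute convergence
means that `φ u > 0` for all `u ≠ 0` (`mellinConverges_iff_decay_pos`).

The rest is convex geometry. Weights are additive on products (`weight_mul`) and superadditive in
`u`. So each `d_u(f i)`, and with it `φ`, is additive on every cone of the normal fan of
`P = P(f_1 ⋯ f_k)` (`decay_add`). If `P` is full-dimensional, these cones contain no lines, and a
vector that does not span its cone can be moved to the boundary of the cone, where more exponents
become minimal (`exists_exit`). An extremal argument then reduces the positivity of `φ` to the rays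
(`decay_pos_of_pos_on_rays`), each of which has a lattice generator because its span is the solution
set of a linear system with integral coefficients (`exists_ray_isLatticeGenerator`). If `P` is not
full-dimensional, `⟨·, u⟩` is constant on `P` for some `u ≠ 0`, and `φ (-u) = -φ u` rules out
convergence (`exists_decay_nonpos`).
-/

namespace MellinTransform

variable {n k : ℕ}

/-! ### Weights of Laurent polynomials -/

lemma le_dotProduct_of_mem_newtonPolytope {h : LaurentPoly n} {u q : Fin n → ℝ} {a : ℝ}
    (ha : ∀ m ∈ exponents h, a ≤ toReal m ⬝ᵥ u) (hq : q ∈ newtonPolytope h) : a ≤ q ⬝ᵥ u := by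
  have hconv : Convex ℝ {w : Fin n → ℝ | a ≤ w ⬝ᵥ u} :=
    convex_halfSpace_ge ⟨fun x y => add_dotProduct x y u, fun r x => smul_dotProduct r x u⟩ a
  refine convexHull_min ?_ hconv hq
  rintro _ ⟨m, hm, rfl⟩
  exact ha m hm

lemma toReal_mem_newtonPolytope {h : LaurentPoly n} {m : Fin n → ℤ} (hm : m ∈ exponents h) :
    toReal m ∈ newtonPolytope h :=
  subset_convexHull _ _ ⟨m, hm, rfl⟩

lemma exponents_nonempty {h : LaurentPoly n} (hh : h ≠ 0) : (exponents h).Nonempty := by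
  rw [exponents, Finsupp.support_nonempty_iff]
  simpa using hh

/-- The minimum of a linear form over the Newton polytope is its minimum over the exponents. -/
lemma weight_isLeast {h : LaurentPoly n} (hh : h ≠ 0) (u : Fin n → ℝ) :
    IsLeast ((fun m => toReal m ⬝ᵥ u) '' (exponents h : Set (Fin n → ℤ))) (weight u h) := by
  obtain ⟨m, hm, hmin⟩ :=
    (exponents h).exists_min_image (fun m => toReal m ⬝ᵥ u) (exponents_nonempty hh)
  have hw : weight u h = toReal m ⬝ᵥ u := by
    refine IsLeast.csInf_eq ⟨⟨toReal m, toReal_mem_newtonPolytope hm, rfl⟩, ?_⟩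
    rintro _ ⟨q, hq, rfl⟩
    exact le_dotProduct_of_mem_newtonPolytope hmin hq
  rw [hw]
  refine ⟨⟨m, hm, rfl⟩, ?_⟩
  rintro _ ⟨q, hq, rfl⟩
  exact hmin q hq

lemma weight_le {h : LaurentPoly n} {m : Fin n → ℤ} (hm : m ∈ exponents h) (u : Fin n → ℝ) :
    weight u h ≤ toReal m ⬝ᵥ u := by
  have hh : h ≠ 0 := by rintro rfl; simp [exponents] at hm
  exact (weight_isLeast hh u).2 ⟨m, hm, rfl⟩

lemma exists_eq_weight {h : LaurentPoly n} (hh : h ≠ 0) (u : Fin n → ℝ) :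
    ∃ m ∈ exponents h, toReal m ⬝ᵥ u = weight u h :=
  (weight_isLeast hh u).1

lemma le_weight {h : LaurentPoly n} (hh : h ≠ 0) {u : Fin n → ℝ} {a : ℝ}
    (ha : ∀ m ∈ exponents h, a ≤ toReal m ⬝ᵥ u) : a ≤ weight u h := by
  obtain ⟨m, hm, hmu⟩ := exists_eq_weight hh u
  exact hmu ▸ ha m hm

lemma weight_smul {h : LaurentPoly n} (hh : h ≠ 0) {r : ℝ} (hr : 0 ≤ r) (u : Fin n → ℝ) :
    weight (r • u) h = r * weight u h := by
  refine le_antisymm ?_ (le_weight hh fun m hm => ?_)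
  · obtain ⟨m, hm, hmu⟩ := exists_eq_weight hh u
    simpa [dotProduct_smul, hmu] using weight_le hm (r • u)
  · simpa [dotProduct_smul] using mul_le_mul_of_nonneg_left (weight_le hm u) hr

lemma weight_add_weight_le {h : LaurentPoly n} (hh : h ≠ 0) (u v : Fin n → ℝ) :
    weight u h + weight v h ≤ weight (u + v) h :=
  le_weight hh fun m hm => by
    rw [dotProduct_add]
    exact add_le_add (weight_le hm u) (weight_le hm v)

lemma abs_dotProduct_le (a u : Fin n → ℝ) : |a ⬝ᵥ u| ≤ (∑ j, |a j|) * ‖u‖ := by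
  rw [Finset.sum_mul]
  refine (Finset.abs_sum_le_sum_abs _ _).trans (Finset.sum_le_sum fun j _ => ?_)
  rw [abs_mul]
  exact mul_le_mul_of_nonneg_left (norm_le_pi_norm u j) (abs_nonneg _)

lemma exists_weight_lipschitz {h : LaurentPoly n} (hh : h ≠ 0) :
    ∃ B : ℝ, ∀ u v : Fin n → ℝ, |weight u h - weight v h| ≤ B * ‖u - v‖ := by
  refine ⟨∑ m ∈ exponents h, ∑ j, |toReal m j|, fun u v => ?_⟩
  have key : ∀ u v : Fin n → ℝ, weight u h - weight v h ≤
      (∑ m ∈ exponents h, ∑ j, |toReal m j|) * ‖u - v‖ := by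
    intro u v
    obtain ⟨m, hm, hmv⟩ := exists_eq_weight hh v
    calc weight u h - weight v h ≤ toReal m ⬝ᵥ u - toReal m ⬝ᵥ v := by
          rw [hmv]; exact sub_le_sub_right (weight_le hm u) _
      _ = toReal m ⬝ᵥ (u - v) := (dotProduct_sub _ _ _).symm
      _ ≤ (∑ j, |toReal m j|) * ‖u - v‖ := (le_abs_self _).trans (abs_dotProduct_le _ _)
      _ ≤ _ := by
          gcongr
          exact Finset.single_le_sum (f := fun m => ∑ j, |toReal m j|)
            (fun m _ => Finset.sum_nonneg fun j _ => abs_nonneg _) hm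
  rw [abs_le]
  refine ⟨?_, key u v⟩
  have := key v u
  rw [norm_sub_rev] at this
  linarith

lemma continuous_weight {h : LaurentPoly n} (hh : h ≠ 0) :
    Continuous fun u : Fin n → ℝ => weight u h := by
  obtain ⟨B, hB⟩ := exists_weight_lipschitz hh
  refine (LipschitzWith.of_dist_le_mul (K := B.toNNReal) fun u v => ?_).continuous
  rw [Real.dist_eq, dist_eq_norm]
  refine (hB u v).trans ?_
  gcongr
  exact Real.le_coe_toNNReal B

lemma toReal_add (a b : Fin n → ℤ) : toReal (a + b) = toReal a + toReal b := by
  ext j; simp [toReal]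

/-- Weights are additive on products: among the exponents of minimal weight of `g` and `h` some pair
has a sum that no other pair has, so the corresponding coefficient of `g * h` is a product of two
non-zero coefficients. -/
lemma weight_mul {g h : LaurentPoly n} (hg : g ≠ 0) (hh : h ≠ 0) (u : Fin n → ℝ) :
    weight u (g * h) = weight u g + weight u h := by
  classical
  have hne : g * h ≠ 0 := mul_ne_zero hg hh
  refine le_antisymm ?_ (le_weight hne fun m hm => ?_)
  · obtain ⟨a, ha, hau⟩ := exists_eq_weight hg u
    obtain ⟨b, hb, hbu⟩ := exists_eq_weight hh u
    obtain ⟨a₀, ha₀, b₀, hb₀, huniq⟩ := UniqueSums.uniqueAdd_of_nonempty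
      (A := {m ∈ exponents g | toReal m ⬝ᵥ u = weight u g})
      (B := {m ∈ exponents h | toReal m ⬝ᵥ u = weight u h})
      ⟨a, by simp [ha, hau]⟩ ⟨b, by simp [hb, hbu]⟩
    rw [Finset.mem_filter] at ha₀ hb₀
    have huniq' : UniqueAdd (exponents g) (exponents h) a₀ b₀ := by
      intro a b ha hb hab
      have h1 := weight_le ha u
      have h2 := weight_le hb u
      have h3 : toReal a ⬝ᵥ u + toReal b ⬝ᵥ u = weight u g + weight u h := by
        rw [← add_dotProduct, ← toReal_add, hab, toReal_add, add_dotProduct, ha₀.2, hb₀.2]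
      refine huniq ?_ ?_ hab <;> rw [Finset.mem_filter]
      · exact ⟨ha, by linarith⟩
      · exact ⟨hb, by linarith⟩
    have hcoeff := AddMonoidAlgebra.coeff_mul_add_of_uniqueAdd huniq'
    have hmem : a₀ + b₀ ∈ exponents (g * h) := by
      rw [exponents, Finsupp.mem_support_iff, hcoeff]
      exact mul_ne_zero (Finsupp.mem_support_iff.1 ha₀.1) (Finsupp.mem_support_iff.1 hb₀.1)
    have := weight_le hmem u
    rwa [toReal_add, add_dotProduct, ha₀.2, hb₀.2] at this
  · obtain ⟨a, ha, b, hb, rfl⟩ := Finset.mem_add.1 (AddMonoidAlgebra.support_coeff_mul_subset g h hm)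
    rw [toReal_add, add_dotProduct]
    exact add_le_add (weight_le ha u) (weight_le hb u)

lemma weight_one (u : Fin n → ℝ) : weight u (1 : LaurentPoly n) = 0 := by
  obtain ⟨m, hm, hmu⟩ := exists_eq_weight (one_ne_zero : (1 : LaurentPoly n) ≠ 0) u
  rw [exponents, AddMonoidAlgebra.one_def] at hm
  have hm0 : m = 0 := by
    simpa using Finsupp.support_single_subset hm
  rw [← hmu, hm0]
  simp [toReal, dotProduct]

lemma weight_prod {ι : Type*} (s : Finset ι) (f : ι → LaurentPoly n) (hf : ∀ i, f i ≠ 0)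
    (u : Fin n → ℝ) : weight u (∏ i ∈ s, f i) = ∑ i ∈ s, weight u (f i) := by
  classical
  induction s using Finset.induction_on with
  | empty => simp [weight_one]
  | insert i s hi ih =>
    rw [Finset.prod_insert hi, Finset.sum_insert hi,
      weight_mul (hf i) (Finset.prod_ne_zero_iff.2 fun j _ => hf j), ih]

/-! ### Cones of the normal fan -/

/-- The combinatorial description of the normal cones: `v` lies in the cone of the face on which
`w` is minimal if and only if every exponent of minimal `w`-weight has minimal `v`-weight. -/
lemma mem_normalCone_face_iff {h : LaurentPoly n} (hh : h ≠ 0) (v w : Fin n → ℝ) :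
    v ∈ normalCone (newtonPolytope h) (face (newtonPolytope h) w) ↔
      ∀ m ∈ exponents h, toReal m ⬝ᵥ w = weight w h → toReal m ⬝ᵥ v = weight v h := by
  constructor
  · intro hv m hm hmw
    have hface : toReal m ∈ face (newtonPolytope h) w :=
      ⟨toReal_mem_newtonPolytope hm, fun q hq =>
        le_dotProduct_of_mem_newtonPolytope (fun m' hm' => hmw ▸ weight_le hm' w) hq⟩
    obtain ⟨m', hm', hmv'⟩ := exists_eq_weight hh v
    refine le_antisymm ?_ (weight_le hm v)
    rw [← hmv']
    exact (hv hface).2 _ (toReal_mem_newtonPolytope hm')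
  · intro hv p hp
    -- For large `K` the form `K • w - v` is still minimal on the exponents of minimal `w`-weight,
    -- and this inequality extends to the convex hull.
    have hK : ∀ᶠ K : ℝ in Filter.atTop, ∀ m ∈ exponents h,
        toReal m ⬝ᵥ v - weight v h ≤ K * (toReal m ⬝ᵥ w - weight w h) := by
      rw [Filter.eventually_all_finset]
      intro m hm
      rcases (weight_le hm w).eq_or_lt with h0 | hpos
      · have := hv m hm h0.symm
        exact Filter.Eventually.of_forall fun K => by rw [this, ← h0]; simp
      · filter_upwards [Filter.eventually_ge_atTop
          ((toReal m ⬝ᵥ v - weight v h) / (toReal m ⬝ᵥ w - weight w h))] with K hK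
        rwa [div_le_iff₀ (sub_pos.2 hpos)] at hK
    obtain ⟨K, hK⟩ := hK.exists
    have hp' : K * weight w h - weight v h ≤ p ⬝ᵥ (K • w - v) := by
      refine le_dotProduct_of_mem_newtonPolytope (fun m hm => ?_) hp.1
      have := hK m hm
      rw [dotProduct_sub, dotProduct_smul, smul_eq_mul]
      linarith
    obtain ⟨m, hm, hmw⟩ := exists_eq_weight hh w
    have hpw : p ⬝ᵥ w = weight w h :=
      le_antisymm (hmw ▸ hp.2 _ (toReal_mem_newtonPolytope hm))
        (le_dotProduct_of_mem_newtonPolytope (fun m hm => weight_le hm w) hp.1)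
    rw [dotProduct_sub, dotProduct_smul, smul_eq_mul, hpw] at hp'
    exact ⟨hp.1, fun q hq =>
      le_trans (by linarith) (le_dotProduct_of_mem_newtonPolytope (fun m hm => weight_le hm v) hq)⟩

lemma eq_zero_of_dotProduct_const {h : LaurentPoly n}
    (hfull : IsFullDimensional (newtonPolytope h)) {u : Fin n → ℝ} {a : ℝ}
    (hu : ∀ m ∈ exponents h, toReal m ⬝ᵥ u = a) : u = 0 := by
  let S : AffineSubspace ℝ (Fin n → ℝ) :=
    { carrier := {p | p ⬝ᵥ u = a}
      smul_vsub_vadd_mem' := fun r p q s hp hq hs => by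
        simp only [Set.mem_ofPred_eq, vsub_eq_sub, vadd_eq_add, add_dotProduct, smul_dotProduct,
          sub_dotProduct] at *
        rw [hp, hq, hs]; simp }
  have hS : affineSpan ℝ (newtonPolytope h) ≤ S := by
    rw [newtonPolytope, affineSpan_convexHull, affineSpan_le]
    rintro _ ⟨m, hm, rfl⟩
    exact hu m hm
  have hall : ∀ p : Fin n → ℝ, p ⬝ᵥ u = a := fun p => hS (by rw [hfull]; trivial)
  have h0 := hall 0
  rw [zero_dotProduct] at h0
  exact dotProduct_self_eq_zero.1 ((hall u).trans h0.symm)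

lemma exists_dotProduct_const {h : LaurentPoly n} (hh : h ≠ 0)
    (hfull : ¬ IsFullDimensional (newtonPolytope h)) :
    ∃ u : Fin n → ℝ, u ≠ 0 ∧ ∃ a, ∀ m ∈ exponents h, toReal m ⬝ᵥ u = a := by
  obtain ⟨m₀, hm₀⟩ := exponents_nonempty hh
  have hm₀' := subset_affineSpan ℝ _ (toReal_mem_newtonPolytope hm₀)
  have hdir : (affineSpan ℝ (newtonPolytope h)).direction < ⊤ :=
    lt_top_iff_ne_top.2 fun hd =>
      hfull ((AffineSubspace.direction_eq_top_iff_of_nonempty ⟨_, hm₀'⟩).1 hd)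
  obtain ⟨g, hg, hker⟩ := Submodule.exists_le_ker_of_lt_top _ hdir
  set u : Fin n → ℝ := fun i => g fun j => if i = j then 1 else 0 with hu
  have hgu : ∀ x, g x = x ⬝ᵥ u := fun x => by
    rw [LinearMap.pi_apply_eq_sum_univ g x]; rfl
  refine ⟨u, ?_, toReal m₀ ⬝ᵥ u, fun m hm => ?_⟩
  · intro h0
    exact hg (LinearMap.ext fun x => by rw [hgu, h0]; simp)
  · have := hker (AffineSubspace.vsub_mem_direction
      (subset_affineSpan ℝ _ (toReal_mem_newtonPolytope hm)) hm₀')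
    rw [LinearMap.mem_ker, hgu, vsub_eq_sub, sub_dotProduct] at this
    linarith

/-- The exponents of minimal `u`-weight. -/
noncomputable def minimalExponents (h : LaurentPoly n) (u : Fin n → ℝ) : Finset (Fin n → ℤ) :=
  {m ∈ exponents h | toReal m ⬝ᵥ u = weight u h}

lemma mem_minimalExponents {h : LaurentPoly n} {u : Fin n → ℝ} {m : Fin n → ℤ} :
    m ∈ minimalExponents h u ↔ m ∈ exponents h ∧ toReal m ⬝ᵥ u = weight u h :=
  Finset.mem_filter

lemma minimalExponents_nonempty {h : LaurentPoly n} (hh : h ≠ 0) (u : Fin n → ℝ) :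
    (minimalExponents h u).Nonempty := by
  obtain ⟨m, hm, hmu⟩ := exists_eq_weight hh u
  exact ⟨m, mem_minimalExponents.2 ⟨hm, hmu⟩⟩

lemma mem_normalCone_iff_minimalExponents_subset {h : LaurentPoly n} (hh : h ≠ 0)
    (v w : Fin n → ℝ) :
    v ∈ normalCone (newtonPolytope h) (face (newtonPolytope h) w) ↔
      minimalExponents h w ⊆ minimalExponents h v := by
  rw [mem_normalCone_face_iff hh]
  refine ⟨fun H m hm => ?_, fun H m hm hmw => ?_⟩
  · rw [mem_minimalExponents] at hm ⊢
    exact ⟨hm.1, H m hm.1 hm.2⟩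
  · exact (mem_minimalExponents.1 (H (mem_minimalExponents.2 ⟨hm, hmw⟩))).2

/-- If `v ≠ 0` lies in the normal cone having `w` in its relative interior, then moving from `w` in
the direction `-v` meets the boundary of the cone, at a point with more minimal exponents. -/
lemma exists_exit {h : LaurentPoly n} (hh : h ≠ 0) (hfull : IsFullDimensional (newtonPolytope h))
    {v w : Fin n → ℝ} (hv : v ≠ 0) (hvw : minimalExponents h w ⊆ minimalExponents h v) :
    ∃ r : ℝ, 0 < r ∧ minimalExponents h w ⊂ minimalExponents h (w - r • v) := by
  classical
  obtain ⟨m₀, hm₀w⟩ := minimalExponents_nonempty hh w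
  have hm₀v := hvw hm₀w
  rw [mem_minimalExponents] at hm₀w hm₀v
  have hne : ({m ∈ exponents h | weight v h < toReal m ⬝ᵥ v}).Nonempty := by
    by_contra hemp
    rw [Finset.not_nonempty_iff_eq_empty, Finset.filter_eq_empty_iff] at hemp
    exact hv (eq_zero_of_dotProduct_const hfull (a := weight v h)
      fun m hm => le_antisymm (not_lt.1 (hemp hm)) (weight_le hm v))
  obtain ⟨m₁, hm₁, hmin⟩ := Finset.exists_min_image _
    (fun m => (toReal m ⬝ᵥ w - weight w h) / (toReal m ⬝ᵥ v - weight v h)) hne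
  rw [Finset.mem_filter] at hm₁
  set r := (toReal m₁ ⬝ᵥ w - weight w h) / (toReal m₁ ⬝ᵥ v - weight v h) with hr
  have hm₁w : weight w h < toReal m₁ ⬝ᵥ w := by
    refine lt_of_le_of_ne (weight_le hm₁.1 w) fun heq => ?_
    have := hvw (mem_minimalExponents.2 ⟨hm₁.1, heq.symm⟩)
    exact hm₁.2.ne' (mem_minimalExponents.1 this).2
  have hr0 : 0 < r := div_pos (sub_pos.2 hm₁w) (sub_pos.2 hm₁.2)
  have hle : ∀ m ∈ exponents h, weight w h - r * weight v h ≤ toReal m ⬝ᵥ (w - r • v) := by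
    intro m hm
    rw [dotProduct_sub, dotProduct_smul, smul_eq_mul]
    have h1 := weight_le hm w
    rcases (weight_le hm v).eq_or_lt with h0 | hpos
    · rw [← h0]; linarith
    · have := hmin m (Finset.mem_filter.2 ⟨hm, hpos⟩)
      rw [le_div_iff₀ (sub_pos.2 hpos)] at this
      linarith
  have hwt : weight (w - r • v) h = weight w h - r * weight v h := by
    refine le_antisymm ?_ (le_weight hh hle)
    have := weight_le hm₀w.1 (w - r • v)
    rwa [dotProduct_sub, dotProduct_smul, smul_eq_mul, hm₀w.2, hm₀v.2] at this
  refine ⟨r, hr0, Finset.ssubset_iff_subset_ne.2 ⟨fun m hm => ?_, fun heq => ?_⟩⟩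
  · have h1 := mem_minimalExponents.1 hm
    have h2 := mem_minimalExponents.1 (hvw hm)
    rw [mem_minimalExponents, hwt, dotProduct_sub, dotProduct_smul, smul_eq_mul, h1.2, h2.2]
    exact ⟨h1.1, rfl⟩
  · have : m₁ ∈ minimalExponents h w := by
      rw [heq, mem_minimalExponents, hwt, dotProduct_sub, dotProduct_smul, smul_eq_mul]
      refine ⟨hm₁.1, ?_⟩
      have := div_mul_cancel₀ (toReal m₁ ⬝ᵥ w - weight w h) (sub_pos.2 hm₁.2).ne'
      rw [← hr] at this
      linarith
    exact hm₁w.ne' (mem_minimalExponents.1 this).2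

/-! ### The exponent of decay -/

/-- The function `u ↦ ⟨a, u⟩ - ∑ i, b i * d_u(f i)`. With `a = Re s` and `b = Re c` it governs the
decay of the Mellin integrand at `t = exp (-u)`. -/
noncomputable def decay (f : Fin k → LaurentPoly n) (a : Fin n → ℝ) (b : Fin k → ℝ) (u : Fin n → ℝ) : ℝ :=
  a ⬝ᵥ u - ∑ i, b i * weight u (f i)

variable {f : Fin k → LaurentPoly n}

lemma decay_smul (hf : ∀ i, f i ≠ 0) (a : Fin n → ℝ) (b : Fin k → ℝ) {r : ℝ} (hr : 0 ≤ r)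
    (u : Fin n → ℝ) : decay f a b (r • u) = r * decay f a b u := by
  simp only [decay, dotProduct_smul, smul_eq_mul, weight_smul (hf _) hr, mul_sub, Finset.mul_sum]
  congr 1
  exact Finset.sum_congr rfl fun i _ => by ring

lemma continuous_decay (hf : ∀ i, f i ≠ 0) (a : Fin n → ℝ) (b : Fin k → ℝ) :
    Continuous (decay f a b) := by
  unfold decay
  refine Continuous.sub (by fun_prop) ?_
  exact continuous_finsetSum _ fun i _ => continuous_const.mul (continuous_weight (hf i))

lemma exists_decay_lipschitz (hf : ∀ i, f i ≠ 0) (a : Fin n → ℝ) (b : Fin k → ℝ) :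
    ∃ B : ℝ, ∀ u v, |decay f a b u - decay f a b v| ≤ B * ‖u - v‖ := by
  choose B hB using fun i => exists_weight_lipschitz (hf i)
  refine ⟨(∑ j, |a j|) + ∑ i, |b i| * B i, fun u v => ?_⟩
  have : decay f a b u - decay f a b v =
      a ⬝ᵥ (u - v) - ∑ i, b i * (weight u (f i) - weight v (f i)) := by
    simp only [decay, dotProduct_sub, mul_sub, Finset.sum_sub_distrib]; ring
  rw [this, add_mul]
  refine (abs_sub _ _).trans (add_le_add (abs_dotProduct_le _ _) ?_)
  rw [Finset.sum_mul]
  refine (Finset.abs_sum_le_sum_abs _ _).trans (Finset.sum_le_sum fun i _ => ?_)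
  rw [abs_mul, mul_assoc]
  exact mul_le_mul_of_nonneg_left (hB i u v) (abs_nonneg _)

/-- Weights of the factors are additive on each cone of the normal fan of the product: they are
superadditive, and their sum, the weight of the product, is additive. -/
lemma decay_add (hf : ∀ i, f i ≠ 0) (a : Fin n → ℝ) (b : Fin k → ℝ) {u v : Fin n → ℝ}
    {m : Fin n → ℤ} (hu : m ∈ minimalExponents (∏ i, f i) u)
    (hv : m ∈ minimalExponents (∏ i, f i) v) :
    decay f a b (u + v) = decay f a b u + decay f a b v := by
  rw [mem_minimalExponents] at hu hv
  have hle : ∀ i ∈ Finset.univ, weight u (f i) + weight v (f i) ≤ weight (u + v) (f i) :=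
    fun i _ => weight_add_weight_le (hf i) u v
  have hsum : ∑ i, (weight u (f i) + weight v (f i)) = ∑ i, weight (u + v) (f i) := by
    refine le_antisymm (Finset.sum_le_sum hle) ?_
    rw [Finset.sum_add_distrib, ← weight_prod _ _ hf, ← weight_prod _ _ hf, ← weight_prod _ _ hf,
      ← hu.2, ← hv.2, ← dotProduct_add]
    exact weight_le hu.1 _
  have heq := (Finset.sum_eq_sum_iff_of_le hle).1 hsum
  simp only [decay, dotProduct_add, ← heq _ (Finset.mem_univ _), mul_add, Finset.sum_add_distrib]
  ring

/-- Positivity of the decay on the generators of the one-dimensional cones of the normal fan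
propagates to all non-zero vectors. Among the vectors with non-positive decay, choose one with as
many minimal exponents as possible; unless it spans its cone, it can be pushed to the boundary of
the cone. -/
lemma decay_pos_of_pos_on_rays (hf : ∀ i, f i ≠ 0)
    (hfull : IsFullDimensional (newtonPolytope (∏ i, f i))) (a : Fin n → ℝ) (b : Fin k → ℝ)
    (hpos : ∀ w : Fin n → ℝ, w ≠ 0 →
      (∀ v, minimalExponents (∏ i, f i) w ⊆ minimalExponents (∏ i, f i) v →
        ∃ r : ℝ, 0 ≤ r ∧ v = r • w) → 0 < decay f a b w)
    {w : Fin n → ℝ} (hw : w ≠ 0) : 0 < decay f a b w := by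
  set h := ∏ i, f i with hdef
  have hh : h ≠ 0 := Finset.prod_ne_zero_iff.2 fun i _ => hf i
  -- The additivity of the decay along a segment that ends on the boundary of a cone.
  have hadd : ∀ {v w : Fin n → ℝ} {r : ℝ}, 0 < r → minimalExponents h w ⊆ minimalExponents h v →
      minimalExponents h w ⊆ minimalExponents h (w - r • v) →
      decay f a b w = decay f a b (w - r • v) + r * decay f a b v := by
    intro v w r hr hv hv'
    obtain ⟨m, hm⟩ := minimalExponents_nonempty hh w
    have hmv : m ∈ minimalExponents h (r • v) := by
      have := mem_minimalExponents.1 (hv hm)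
      rw [mem_minimalExponents, dotProduct_smul, weight_smul hh hr.le, this.2]
      exact ⟨this.1, rfl⟩
    rw [← decay_smul hf a b hr.le, ← decay_add hf a b (hv' hm) hmv, sub_add_cancel]
  by_contra hcon
  obtain ⟨N, ⟨w, hw0, hwneg, rfl⟩, hmax⟩ : ∃ N, (∃ w : Fin n → ℝ, w ≠ 0 ∧ decay f a b w ≤ 0 ∧
      (minimalExponents h w).card = N) ∧ ∀ w' : Fin n → ℝ, w' ≠ 0 → decay f a b w' ≤ 0 →
      (minimalExponents h w').card ≤ N := by
    classical
    have hbd : ∀ N, (∃ w : Fin n → ℝ, w ≠ 0 ∧ decay f a b w ≤ 0 ∧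
        (minimalExponents h w).card = N) → N ≤ (exponents h).card := by
      rintro N ⟨w, -, -, rfl⟩
      exact Finset.card_le_card (Finset.filter_subset _ _)
    set p : ℕ → Prop := fun N => ∃ w : Fin n → ℝ, w ≠ 0 ∧ decay f a b w ≤ 0 ∧
      (minimalExponents h w).card = N with hp
    have hpw : p (minimalExponents h w).card := ⟨w, hw, not_lt.1 hcon, rfl⟩
    refine ⟨_, Nat.findGreatest_spec (hbd _ hpw) hpw, fun w' hw' hneg' => ?_⟩
    exact Nat.le_findGreatest (hbd _ ⟨w', hw', hneg', rfl⟩) ⟨w', hw', hneg', rfl⟩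
  have hstrict : ∀ w' : Fin n → ℝ, w' ≠ 0 → minimalExponents h w ⊂ minimalExponents h w' →
      0 < decay f a b w' := fun w' hw' hss =>
    not_le.1 fun hneg => (Finset.card_lt_card hss).not_ge (hmax w' hw' hneg)
  refine hwneg.not_gt (hpos w hw0 fun v hv => ?_)
  by_contra hvw
  have hv0 : v ≠ 0 := fun h0 => hvw ⟨0, le_rfl, by simp [h0]⟩
  obtain ⟨r, hr, hss⟩ := exists_exit hh hfull hv0 hv
  have hw'0 : w - r • v ≠ 0 := fun h0 => hvw ⟨r⁻¹, (inv_pos.2 hr).le, by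
    rw [sub_eq_zero.1 h0, smul_smul, inv_mul_cancel₀ hr.ne', one_smul]⟩
  have hw'pos := hstrict _ hw'0 hss
  have hdec := hadd hr hv hss.subset
  have hvneg : decay f a b v < 0 := by
    by_contra hge
    have := mul_nonneg hr.le (not_lt.1 hge)
    linarith
  have hveq : minimalExponents h w = minimalExponents h v := by
    by_contra hne
    exact (hstrict v hv0 (Finset.ssubset_iff_subset_ne.2 ⟨hv, hne⟩)).not_gt hvneg
  have hsub : minimalExponents h v ⊆ minimalExponents h (w - r • v) := hveq ▸ hss.subset
  obtain ⟨r', hr', hss'⟩ := exists_exit hh hfull hw'0 hsub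
  have hdec' := hadd hr' hsub hss'.subset
  have hneg' : decay f a b (v - r' • (w - r • v)) < 0 := by
    have := mul_pos hr' hw'pos
    linarith
  refine (hstrict _ ?_ (hveq ▸ hss')).not_gt hneg'
  intro h0
  rw [h0] at hneg'
  have := decay_smul hf a b le_rfl (0 : Fin n → ℝ)
  rw [smul_zero, zero_mul] at this
  exact hneg'.ne this

/-! ### Rays and their lattice generators -/

/-- A homogeneous linear system with integral coefficients that has a non-trivial real solution has
a non-trivial integral solution: the Gram matrix of the columns is singular over `ℝ`, hence
over `ℤ`. -/
lemma exists_int_mulVec_eq_zero {ι : Type*} [Fintype ι] (A : Matrix ι (Fin n) ℤ) {w : Fin n → ℝ}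
    (hw : w ≠ 0) (hAw : (A.map (Int.castRingHom ℝ)).mulVec w = 0) :
    ∃ v : Fin n → ℤ, v ≠ 0 ∧ A.mulVec v = 0 := by
  have hdet : ((A.transpose * A).map (Int.castRingHom ℝ)).det = 0 := by
    refine Matrix.exists_mulVec_eq_zero_iff.1 ⟨w, hw, ?_⟩
    rw [Matrix.map_mul, ← Matrix.mulVec_mulVec, hAw, Matrix.mulVec_zero]
  rw [← RingHom.mapMatrix_apply, ← RingHom.map_det] at hdet
  have hdet' : (A.transpose * A).det = 0 := by simpa using hdet
  obtain ⟨v, hv, hAv⟩ := Matrix.exists_mulVec_eq_zero_iff.2 hdet'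
  refine ⟨v, hv, dotProduct_self_eq_zero.1 ?_⟩
  rw [Matrix.dotProduct_mulVec, ← Matrix.mulVec_transpose, Matrix.mulVec_mulVec, hAv,
    zero_dotProduct]

lemma toReal_ne_zero {v : Fin n → ℤ} (hv : v ≠ 0) : toReal v ≠ 0 := by
  intro h0
  refine hv (funext fun j => ?_)
  have := congrFun h0 j
  simpa [toReal] using this

/-- The ray through a non-zero lattice point has a lattice generator. -/
lemma exists_isLatticeGenerator {v : Fin n → ℤ} (hv : v ≠ 0) :
    ∃ (u : Fin n → ℤ) (g : ℝ), 0 < g ∧ toReal v = g • toReal u ∧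
      IsLatticeGenerator {x | ∃ r : ℝ, 0 ≤ r ∧ x = r • toReal v} u := by
  obtain ⟨i, hi⟩ := Function.ne_iff.1 hv
  obtain ⟨u, hu, hgcd⟩ := Finset.extract_gcd (s := Finset.univ) v ⟨i, Finset.mem_univ i⟩
  set g : ℤ := Finset.univ.gcd v with hg
  have hg0 : 0 < g := by
    have h1 : 0 ≤ g := Int.nonneg_of_normalize_eq_self Finset.normalize_gcd
    refine lt_of_le_of_ne h1 fun h0 => hi ?_
    rw [hu i (Finset.mem_univ i), ← h0]
    simp
  have hgR : (0 : ℝ) < g := by exact_mod_cast hg0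
  have hvu : toReal v = (g : ℝ) • toReal u := by
    ext j
    simp [toReal, hu j (Finset.mem_univ j)]
  refine ⟨u, g, hgR, hvu, ?_, ?_⟩
  · ext x
    constructor
    · rintro ⟨r, hr, rfl⟩
      exact ⟨r * g, by positivity, by rw [hvu, smul_smul]⟩
    · rintro ⟨r, hr, rfl⟩
      exact ⟨r / g, by positivity, by rw [hvu, smul_smul, div_mul_cancel₀ _ hgR.ne']⟩
  · rintro x ⟨r, hr, hx⟩
    obtain ⟨a, ha⟩ := Finset.gcd_eq_sum_mul Finset.univ u
    rw [hgcd] at ha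
    rw [hvu, smul_smul] at hx
    -- The factor relating `x` to the primitive vector `u` is an integer by Bézout.
    have hint : r * g = ((∑ j, x j * a j : ℤ) : ℝ) := by
      have h1 : (1 : ℝ) = ∑ j, (u j : ℝ) * a j := by exact_mod_cast ha
      have h2 : ∀ j, (x j : ℝ) = r * g * u j := fun j => congrFun hx j
      push_cast
      simp only [h2]
      calc r * g = r * g * ∑ j, (u j : ℝ) * a j := by rw [← h1, mul_one]
        _ = _ := by rw [Finset.mul_sum]; exact Finset.sum_congr rfl fun j _ => by ring
    have hnn : 0 ≤ ∑ j, x j * a j := by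
      have : (0 : ℝ) ≤ r * g := by positivity
      rw [hint] at this
      exact_mod_cast this
    refine ⟨(∑ j, x j * a j).toNat, funext fun j => ?_⟩
    have h2 : (x j : ℝ) = r * g * u j := congrFun hx j
    rw [hint] at h2
    have h3 : x j = (∑ j, x j * a j) * u j := by exact_mod_cast h2
    rw [Pi.smul_apply, nsmul_eq_mul, Int.natCast_toNat_eq_self.2 hnn]
    exact h3

lemma weight_neg_of_const {h : LaurentPoly n} (hh : h ≠ 0) {u : Fin n → ℝ} {a : ℝ}
    (hu : ∀ m ∈ exponents h, toReal m ⬝ᵥ u = a) : weight u h = a ∧ weight (-u) h = -a := by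
  obtain ⟨m, hm, hmu⟩ := exists_eq_weight hh u
  obtain ⟨m', hm', hmu'⟩ := exists_eq_weight hh (-u)
  rw [hu m hm] at hmu
  rw [dotProduct_neg, hu m' hm'] at hmu'
  exact ⟨hmu.symm, hmu'.symm⟩

/-- A linear form that is constant on the exponents of minimal `w`-weight is, up to a multiple
of `w`, in the normal cone of `w`. -/
lemma exists_smul_add_minimalExponents_subset {h : LaurentPoly n} (hh : h ≠ 0)
    {v w : Fin n → ℝ} {a : ℝ} (hv : ∀ m ∈ minimalExponents h w, toReal m ⬝ᵥ v = a) :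
    ∃ K : ℝ, minimalExponents h w ⊆ minimalExponents h (K • w + v) := by
  have hK : ∀ᶠ K : ℝ in Filter.atTop, ∀ m ∈ exponents h,
      a - toReal m ⬝ᵥ v ≤ K * (toReal m ⬝ᵥ w - weight w h) := by
    rw [Filter.eventually_all_finset]
    intro m hm
    rcases (weight_le hm w).eq_or_lt with h0 | hpos
    · have := hv m (mem_minimalExponents.2 ⟨hm, h0.symm⟩)
      exact Filter.Eventually.of_forall fun K => by rw [this, ← h0]; simp
    · filter_upwards [Filter.eventually_ge_atTop
        ((a - toReal m ⬝ᵥ v) / (toReal m ⬝ᵥ w - weight w h))] with K hK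
      rwa [div_le_iff₀ (sub_pos.2 hpos)] at hK
  obtain ⟨K, hK⟩ := hK.exists
  refine ⟨K, fun m hm => ?_⟩
  have hm' := mem_minimalExponents.1 hm
  refine mem_minimalExponents.2 ⟨hm'.1, le_antisymm (le_weight hh fun m' h' => ?_)
    (weight_le hm'.1 _)⟩
  have := hK m' h'
  rw [dotProduct_add, dotProduct_smul, smul_eq_mul, dotProduct_add, dotProduct_smul, smul_eq_mul,
    hm'.2, hv m hm]
  linarith

/-- If the normal cone of `w` consists of the non-negative multiples of `w`, then it is a ray of
the normal fan, and it contains a lattice generator. -/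
lemma exists_ray_isLatticeGenerator {h : LaurentPoly n} (hh : h ≠ 0)
    {w : Fin n → ℝ} (hw : w ≠ 0)
    (hray : ∀ v, minimalExponents h w ⊆ minimalExponents h v → ∃ r : ℝ, 0 ≤ r ∧ v = r • w) :
    ∃ ρ ∈ rays (newtonPolytope h), ∃ u : Fin n → ℤ, IsLatticeGenerator ρ u ∧
      ∃ r : ℝ, 0 < r ∧ w = r • toReal u := by
  set ρ := normalCone (newtonPolytope h) (face (newtonPolytope h) w) with hρ
  have hρw : ρ = {x | ∃ r : ℝ, 0 ≤ r ∧ x = r • w} := by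
    ext x
    rw [hρ, mem_normalCone_iff_minimalExponents_subset hh]
    refine ⟨hray x, ?_⟩
    rintro ⟨r, hr, rfl⟩ m hm
    rw [mem_minimalExponents] at hm ⊢
    rw [dotProduct_smul, weight_smul hh hr, hm.2]
    exact ⟨hm.1, rfl⟩
  have hspan : Submodule.span ℝ ρ = Submodule.span ℝ {w} := by
    refine le_antisymm (Submodule.span_le.2 ?_) (Submodule.span_mono ?_)
    · rw [hρw]
      rintro _ ⟨r, -, rfl⟩
      exact Submodule.smul_mem _ _ (Submodule.mem_span_singleton_self w)
    · rw [hρw, Set.singleton_subset_iff]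
      exact ⟨1, zero_le_one, (one_smul _ _).symm⟩
  have hmem : ρ ∈ rays (newtonPolytope h) :=
    ⟨⟨w, rfl⟩, by rw [hspan]; exact finrank_span_singleton hw⟩
  obtain ⟨m₀, hm₀⟩ := minimalExponents_nonempty hh w
  obtain ⟨v, hv, hAv⟩ := exists_int_mulVec_eq_zero (ι := minimalExponents h w)
    (Matrix.of fun m j => m.1 j - m₀ j) hw (by
      ext m
      have h1 := (mem_minimalExponents.1 m.2).2
      rw [← (mem_minimalExponents.1 hm₀).2, ← sub_eq_zero, ← sub_dotProduct] at h1
      rw [Pi.zero_apply, ← h1]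
      simp [Matrix.mulVec, dotProduct, toReal])
  have hconst : ∀ m ∈ minimalExponents h w, toReal m ⬝ᵥ toReal v = toReal m₀ ⬝ᵥ toReal v := by
    intro m hm
    have h1 := congrFun hAv ⟨m, hm⟩
    have h2 : ∑ j, ((m j : ℝ) - m₀ j) * v j = 0 := by
      simp only [Matrix.mulVec, dotProduct, Matrix.of_apply, Pi.zero_apply] at h1
      exact_mod_cast h1
    rw [← sub_eq_zero, ← sub_dotProduct]
    exact h2
  obtain ⟨K, hK⟩ := exists_smul_add_minimalExponents_subset hh hconst
  obtain ⟨r, -, hr⟩ := hray _ hK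
  have hvr : toReal v = (r - K) • w := by
    rw [sub_smul, ← hr]; simp
  -- Up to its sign, `v` is a positive multiple of `w`.
  obtain ⟨v', hv', q, hq, hvq⟩ : ∃ v' : Fin n → ℤ, v' ≠ 0 ∧ ∃ q : ℝ, 0 < q ∧ toReal v' = q • w := by
    rcases lt_trichotomy (r - K) 0 with hneg | h0 | hpos
    · refine ⟨-v, neg_ne_zero.2 hv, -(r - K), neg_pos.2 hneg, ?_⟩
      rw [neg_smul, ← hvr]
      ext j; simp [toReal]
    · exact absurd (by rw [hvr, h0, zero_smul]) (toReal_ne_zero hv)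
    · exact ⟨v, hv, r - K, hpos, hvr⟩
  have hwv : w = q⁻¹ • toReal v' := by
    rw [hvq, smul_smul, inv_mul_cancel₀ hq.ne', one_smul]
  have hρv : ρ = {x | ∃ r : ℝ, 0 ≤ r ∧ x = r • toReal v'} := by
    rw [hρw]
    ext x
    constructor
    · rintro ⟨r, hr, rfl⟩
      exact ⟨r * q⁻¹, by positivity, by rw [mul_smul, ← hwv]⟩
    · rintro ⟨r, hr, rfl⟩
      exact ⟨r * q, by positivity, by rw [hvq, smul_smul]⟩
  obtain ⟨u, g, hg, hgu, hgen⟩ := exists_isLatticeGenerator hv'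
  exact ⟨ρ, hmem, u, hρv ▸ hgen, q⁻¹ * g, by positivity, by rw [hwv, hgu, smul_smul]⟩

/-! ### The region of convergence -/

lemma decay_re_toReal (s : Fin n → ℂ) (c : Fin k → ℂ) (u : Fin n → ℤ) :
    decay f (fun j => (s j).re) (fun i => (c i).re) (toReal u) =
      (∑ j, s j * (u j : ℂ)).re - (weightSum f (toReal u) c).re := by
  simp [decay, weightSum, dotProduct, toReal]

/-- The finitely many conditions that define the region of convergence say that the decay is
positive in every direction. -/
lemma mem_convergenceRegion_iff (hf : ∀ i, f i ≠ 0)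
    (hfull : IsFullDimensional (newtonPolytope (∏ i, f i))) (s : Fin n → ℂ) (c : Fin k → ℂ) :
    (s, c) ∈ convergenceRegion f ↔
      ∀ u : Fin n → ℝ, u ≠ 0 → 0 < decay f (fun j => (s j).re) (fun i => (c i).re) u := by
  have hh : ∏ i, f i ≠ 0 := Finset.prod_ne_zero_iff.2 fun i _ => hf i
  constructor
  · intro hmem u hu
    refine decay_pos_of_pos_on_rays hf hfull _ _ (fun w hw hray => ?_) hu
    obtain ⟨ρ, hρ, u, hu, r, hr, rfl⟩ := exists_ray_isLatticeGenerator hh hw hray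
    rw [decay_smul hf _ _ hr.le, decay_re_toReal]
    exact mul_pos hr (sub_pos.2 (hmem ρ hρ u hu))
  · intro hpos ρ hρ u hu
    rw [← sub_pos, ← decay_re_toReal]
    refine hpos _ fun h0 => ?_
    have hspan : Submodule.span ℝ ρ = ⊥ := by
      rw [Submodule.span_eq_bot, hu.1]
      rintro _ ⟨r, -, rfl⟩
      rw [h0, smul_zero]
    have := hρ.2
    rw [hspan, finrank_bot] at this
    exact zero_ne_one this

/-- The region contains the point `c = (1, …, 1)`, with `s` the barycentre of the exponents of the
product, which lies in the interior of the Newton polytope. -/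
lemma convergenceRegion_nonempty (hf : ∀ i, f i ≠ 0)
    (hfull : IsFullDimensional (newtonPolytope (∏ i, f i))) : (convergenceRegion f).Nonempty := by
  set h := ∏ i, f i with hdef
  have hh : h ≠ 0 := Finset.prod_ne_zero_iff.2 fun i _ => hf i
  have hcard : (0 : ℝ) < (exponents h).card := by exact_mod_cast (exponents_nonempty hh).card_pos
  set p : Fin n → ℝ := ((exponents h).card : ℝ)⁻¹ • ∑ m ∈ exponents h, toReal m with hp
  refine ⟨(fun j => (p j : ℂ), fun _ => 1), (mem_convergenceRegion_iff hf hfull _ _).2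
    fun u hu => ?_⟩
  simp only [decay, Complex.ofReal_re, Complex.one_re, one_mul]
  rw [← weight_prod _ _ hf, ← hdef, sub_pos]
  change weight u h < p ⬝ᵥ u
  rw [hp, smul_dotProduct, sum_dotProduct, smul_eq_mul, lt_inv_mul_iff₀ hcard, ← nsmul_eq_mul]
  rw [← Finset.sum_const]
  refine Finset.sum_lt_sum (fun m hm => weight_le hm u) ?_
  by_contra! hcon
  exact hu (eq_zero_of_dotProduct_const hfull (a := weight u h)
    fun m hm => le_antisymm (hcon m hm) (weight_le hm u))

/-- If the Newton polytope of the product lies in a hyperplane `⟨·, u⟩ = a`, then the weights of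
`u` and `-u` of every factor cancel, so the decay is odd on the line through `u`. -/
lemma exists_decay_nonpos (hf : ∀ i, f i ≠ 0)
    (hfull : ¬ IsFullDimensional (newtonPolytope (∏ i, f i))) (a : Fin n → ℝ) (b : Fin k → ℝ) :
    ∃ u : Fin n → ℝ, u ≠ 0 ∧ decay f a b u ≤ 0 := by
  have hh : ∏ i, f i ≠ 0 := Finset.prod_ne_zero_iff.2 fun i _ => hf i
  obtain ⟨u, hu, e, he⟩ := exists_dotProduct_const hh hfull
  have hodd : decay f a b 0 = decay f a b u + decay f a b (-u) := by
    obtain ⟨m, hm⟩ := exponents_nonempty hh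
    have hw := weight_neg_of_const hh he
    rw [← add_neg_cancel u]
    refine decay_add hf a b (m := m) (mem_minimalExponents.2 ⟨hm, ?_⟩)
      (mem_minimalExponents.2 ⟨hm, ?_⟩)
    · rw [hw.1, he m hm]
    · rw [hw.2, dotProduct_neg, he m hm]
  have h0 : decay f a b 0 = 0 := by simpa using decay_smul hf a b le_rfl (0 : Fin n → ℝ)
  rcases le_total (decay f a b u) 0 with hle | hge
  · exact ⟨u, hu, hle⟩
  · exact ⟨-u, neg_ne_zero.2 hu, by linarith⟩

/-! ### Integrability of exponentials of homogeneous functions -/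

section Homogeneous

variable {E : Type*} [NormedAddCommGroup E] [NormedSpace ℝ E] [FiniteDimensional ℝ E]
  [MeasurableSpace E] [BorelSpace E] (μ : Measure E) [μ.IsAddHaarMeasure]

lemma integrable_exp_neg_mul_norm {ε : ℝ} (hε : 0 < ε) :
    Integrable (fun x : E => Real.exp (-(ε * ‖x‖))) μ := by
  set N := Module.finrank ℝ E + 1 with hN
  have hint : Integrable (fun x : E => (1 + ‖x‖) ^ (-(N : ℝ))) μ :=
    integrable_one_add_norm (by rw [hN]; push_cast; linarith)
  refine (hint.const_mul (Real.exp ε * (N.factorial / ε ^ N))).mono'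
    (by fun_prop) (Filter.Eventually.of_forall fun x => ?_)
  have hx : 0 < 1 + ‖x‖ := by positivity
  rw [Real.norm_of_nonneg (Real.exp_pos _).le, Real.rpow_neg hx.le, Real.rpow_natCast]
  have h1 := Real.pow_div_factorial_le_exp (ε * (1 + ‖x‖)) (by positivity) N
  rw [mul_pow, div_le_iff₀ (by positivity)] at h1
  have h2 : Real.exp (ε * (1 + ‖x‖)) * Real.exp (-(ε * ‖x‖)) = Real.exp ε := by
    rw [← Real.exp_add]; congr 1; ring
  have h3 : Real.exp ε * (N.factorial / ε ^ N) * ((1 + ‖x‖) ^ N)⁻¹ =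
      Real.exp ε * N.factorial / (ε ^ N * (1 + ‖x‖) ^ N) := by
    field_simp
  rw [h3, le_div_iff₀ (by positivity), ← h2]
  calc Real.exp (-(ε * ‖x‖)) * (ε ^ N * (1 + ‖x‖) ^ N)
      ≤ Real.exp (-(ε * ‖x‖)) * (Real.exp (ε * (1 + ‖x‖)) * N.factorial) := by gcongr
    _ = _ := by ring

/-- If `φ` is non-positive at some `u ≠ 0`, then it is bounded above on a tube around the ray
through `u`, which contains infinitely many disjoint unit balls. If it is positive away from `0`, it
dominates a multiple of the norm. -/
lemma integrable_exp_neg_iff {φ : E → ℝ} (hcont : Continuous φ)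
    (hhom : ∀ (r : ℝ) (u : E), 0 ≤ r → φ (r • u) = r * φ u)
    (hlip : ∃ B : ℝ, ∀ u v, |φ u - φ v| ≤ B * ‖u - v‖) :
    Integrable (fun u => Real.exp (-φ u)) μ ↔ ∀ u, u ≠ 0 → 0 < φ u := by
  constructor
  · intro hint u hu
    by_contra hneg
    rw [not_lt] at hneg
    obtain ⟨B, hB⟩ := hlip
    have hu0 : 0 < ‖u‖ := norm_pos_iff.2 hu
    set w := (2 / ‖u‖) • u with hw
    have hwn : ‖w‖ = 2 := by
      rw [hw, norm_smul, Real.norm_of_nonneg (by positivity), div_mul_cancel₀ _ hu0.ne']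
    have hφw : φ w ≤ 0 := by
      rw [hw, hhom _ _ (by positivity)]
      exact mul_nonpos_of_nonneg_of_nonpos (by positivity) hneg
    have hfin := hint.measure_ge_lt_top (Real.exp_pos (-|B|))
    have hsub : (⋃ j : ℕ, Metric.ball ((j : ℝ) • w) 1) ⊆
        {x | Real.exp (-|B|) ≤ Real.exp (-φ x)} := by
      refine Set.iUnion_subset fun j x hx => ?_
      rw [mem_ball_iff_norm] at hx
      have h1 := (abs_le.1 (hB x ((j : ℝ) • w))).2
      have h2 : φ ((j : ℝ) • w) ≤ 0 := by
        rw [hhom _ _ (Nat.cast_nonneg j)]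
        exact mul_nonpos_of_nonneg_of_nonpos (Nat.cast_nonneg j) hφw
      have h3 : B * ‖x - (j : ℝ) • w‖ ≤ |B| * 1 :=
        mul_le_mul (le_abs_self B) hx.le (norm_nonneg _) (abs_nonneg B)
      rw [Set.mem_ofPred_eq, Real.exp_le_exp]
      linarith
    have hdisj : Pairwise (Function.onFun Disjoint
        fun j : ℕ => Metric.ball ((j : ℝ) • w) 1) := by
      intro i j hij
      refine Metric.ball_disjoint_ball ?_
      rw [dist_eq_norm, ← sub_smul, norm_smul, hwn, Real.norm_eq_abs]
      have h1 : (1 : ℝ) ≤ |(i : ℝ) - j| := by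
        have : (1 : ℤ) ≤ |(i : ℤ) - j| :=
          Int.one_le_abs (sub_ne_zero.2 (by exact_mod_cast hij))
        exact_mod_cast this
      linarith
    have htop : μ (⋃ j : ℕ, Metric.ball ((j : ℝ) • w) 1) = ⊤ := by
      rw [measure_iUnion hdisj fun j => Metric.isOpen_ball.measurableSet]
      simp only [Measure.addHaar_ball_center]
      exact ENNReal.tsum_const_eq_top_of_ne_zero
        (Metric.measure_ball_pos μ _ one_pos).ne'
    exact (htop ▸ measure_mono hsub).not_gt hfin
  · intro hpos
    obtain ⟨ε, hε, hle⟩ : ∃ ε : ℝ, 0 < ε ∧ ∀ u, ε * ‖u‖ ≤ φ u := by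
      have h0 : φ 0 = 0 := by simpa using hhom 0 0 le_rfl
      rcases (Metric.sphere (0 : E) 1).eq_empty_or_nonempty with hemp | hne
      · refine ⟨1, one_pos, fun u => ?_⟩
        by_cases hu : u = 0
        · simp [hu, h0]
        · have : ‖u‖⁻¹ • u ∈ Metric.sphere (0 : E) 1 := by
            rw [mem_sphere_zero_iff_norm, norm_smul, norm_inv, norm_norm,
              inv_mul_cancel₀ (norm_ne_zero_iff.2 hu)]
          rw [hemp] at this
          exact this.elim
      · obtain ⟨x, hx, hmin⟩ := (isCompact_sphere (0 : E) 1).exists_isMinOn hne hcont.continuousOn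
        refine ⟨φ x, hpos x (ne_zero_of_mem_unit_sphere ⟨x, hx⟩), fun u => ?_⟩
        by_cases hu : u = 0
        · simp [hu, h0]
        · have hu0 : 0 < ‖u‖ := norm_pos_iff.2 hu
          have : ‖u‖⁻¹ • u ∈ Metric.sphere (0 : E) 1 := by
            rw [mem_sphere_zero_iff_norm, norm_smul, norm_inv, norm_norm,
              inv_mul_cancel₀ hu0.ne']
          have h1 : φ x ≤ φ (‖u‖⁻¹ • u) := hmin this
          rw [hhom _ _ (by positivity), le_inv_mul_iff₀ hu0] at h1
          linarith
    refine (integrable_exp_neg_mul_norm μ hε).mono' (by fun_prop)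
      (Filter.Eventually.of_forall fun u => ?_)
    rw [Real.norm_of_nonneg (Real.exp_pos _).le, Real.exp_le_exp]
    exact neg_le_neg (hle u)

end Homogeneous

/-! ### Open strongly convex cones and branches of the logarithm -/

namespace IsOpenStronglyConvexCone

variable {U : Set ℂ}

lemma isOpen (hU : IsOpenStronglyConvexCone U) : IsOpen U := by
  obtain ⟨σ, -, -, rfl⟩ := hU
  exact isOpen_interior

lemma convex (hU : IsOpenStronglyConvexCone U) : Convex ℝ U := by
  obtain ⟨σ, -, -, rfl⟩ := hU
  exact (σ : ConvexCone ℝ ℂ).convex.interior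

open scoped Pointwise in
lemma smul_mem (hU : IsOpenStronglyConvexCone U) {r : ℝ} (hr : 0 < r) {w : ℂ} (hw : w ∈ U) :
    r • w ∈ U := by
  obtain ⟨σ, -, -, rfl⟩ := hU
  have hsub : r • (σ : Set ℂ) ⊆ (σ : Set ℂ) := by
    rintro _ ⟨x, hx, rfl⟩
    exact (σ : ConvexCone ℝ ℂ).smul_mem hr hx
  refine interior_mono hsub ?_
  rw [interior_smul₀ hr.ne']
  exact Set.smul_mem_smul_set hw

lemma zero_notMem (hU : IsOpenStronglyConvexCone U) : (0 : ℂ) ∉ U := by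
  obtain ⟨σ, -, hs, rfl⟩ := hU
  intro h0
  obtain ⟨ε, hε, hball⟩ := Metric.mem_nhds_iff.1 (mem_interior_iff_mem_nhds.1 h0)
  have hx : ((ε / 2 : ℝ) : ℂ) ∈ σ := hball (by
    rw [mem_ball_zero_iff, Complex.norm_of_nonneg (by positivity)]; linarith)
  have hx' : -((ε / 2 : ℝ) : ℂ) ∈ σ := hball (by
    rw [mem_ball_zero_iff, norm_neg, Complex.norm_of_nonneg (by positivity)]; linarith)
  exact hs _ hx (by exact_mod_cast (half_pos hε).ne') hx'

/-- An open strongly convex cone lies in an open half-plane bounded by a line through `0`. -/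
lemma exists_pos (hU : IsOpenStronglyConvexCone U) :
    ∃ g : ℂ →L[ℝ] ℝ, ∀ w ∈ U, 0 < g w := by
  obtain ⟨g, hg⟩ := geometric_hahn_banach_open_point hU.convex hU.isOpen hU.zero_notMem
  refine ⟨-g, fun w hw => ?_⟩
  have := hg w hw
  rw [map_zero] at this
  simpa using this

/-- A branch of the logarithm on a cone in a half-plane differs from a rotated principal branch by
a constant, so its imaginary part is bounded. -/
lemma exists_abs_im_le (hU : IsOpenStronglyConvexCone U) {L : ℂ → ℂ} (hL : IsLogBranch L U) :
    ∃ C : ℝ, ∀ w ∈ U, |(L w).im| ≤ C := by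
  obtain ⟨g, hg⟩ := hU.exists_pos
  set a : ℂ := ⟨g 1, -g Complex.I⟩ with ha
  have hre : ∀ w, (a * w).re = g w := by
    intro w
    have : w = w.re • (1 : ℂ) + w.im • Complex.I := by
      apply Complex.ext <;> simp
    conv_rhs => rw [this]
    rw [map_add, map_smul, map_smul, Complex.mul_re, smul_eq_mul, smul_eq_mul, ha]
    ring
  have hslit : ∀ w ∈ U, a * w ∈ Complex.slitPlane := fun w hw => Or.inl (by
    rw [hre]; exact hg w hw)
  set q : ℂ → ℝ := fun w => (Complex.arg (a * w) - (L w).im - Complex.arg a) / (2 * Real.pi)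
    with hq
  have hqc : ContinuousOn q U := by
    refine ContinuousOn.div_const (ContinuousOn.sub (ContinuousOn.sub ?_ ?_) continuousOn_const) _
    · exact fun w hw => ContinuousAt.continuousWithinAt
        ((Complex.continuousAt_arg (hslit w hw)).comp (f := fun w => a * w) (by fun_prop))
    · exact Complex.continuous_im.comp_continuousOn hL.1
  have hqm : Set.MapsTo q U (Set.range ((↑) : ℤ → ℝ)) := by
    intro w hw
    have haw := Complex.slitPlane_ne_zero (hslit w hw)
    have ha0 : a ≠ 0 := left_ne_zero_of_mul haw
    have hexp : Complex.exp (Complex.log (a * w)) = Complex.exp (L w + Complex.log a) := by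
      rw [Complex.exp_add, Complex.exp_log haw, Complex.exp_log ha0, hL.2 w hw, mul_comm]
    obtain ⟨N, hN⟩ := Complex.exp_eq_exp_iff_exists_int.1 hexp
    refine ⟨N, ?_⟩
    have him := congrArg Complex.im hN
    simp only [Complex.log_im, Complex.add_im, Complex.mul_im, Complex.intCast_re,
      Complex.intCast_im, Complex.I_im, Complex.I_re] at him
    rw [hq]
    simp only
    rw [him, eq_div_iff (by positivity)]
    simp
    ring
  obtain ⟨y, -, hy⟩ := hU.convex.isPreconnected.eqOn_const_of_mapsTo
    (Int.isClosedEmbedding_coe_real.isInducing.isDiscrete_range) hqc hqm (Set.range_nonempty _)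
  refine ⟨Real.pi + Real.pi + |y| * (2 * Real.pi), fun w hw => ?_⟩
  have hyw : q w = y := hy hw
  have hpi := Real.pi_pos
  have h1 : (L w).im = Complex.arg (a * w) - Complex.arg a - y * (2 * Real.pi) := by
    rw [← hyw, hq]
    simp only
    rw [div_mul_cancel₀ _ (by positivity)]
    ring
  rw [h1]
  refine (abs_sub _ _).trans (add_le_add ((abs_sub _ _).trans
    (add_le_add (Complex.abs_arg_le_pi _) (Complex.abs_arg_le_pi _))) ?_)
  rw [abs_mul, abs_of_pos (by positivity : 0 < 2 * Real.pi)]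

end IsOpenStronglyConvexCone

lemma IsLogBranch.re_eq {L : ℂ → ℂ} {U : Set ℂ} (hL : IsLogBranch L U) {w : ℂ} (hw : w ∈ U) :
    (L w).re = Real.log ‖w‖ := by
  conv_rhs => rw [← hL.2 w hw]
  rw [Complex.norm_exp, Real.log_exp]

/-! ### The size of a Laurent polynomial -/

lemma evalAt_exp_neg (h : LaurentPoly n) (u : Fin n → ℝ) :
    evalAt h (fun j => Real.exp (-u j)) =
      ∑ m ∈ exponents h, Real.exp (-(toReal m ⬝ᵥ u)) • h.coeff m := by
  refine Finset.sum_congr rfl fun m _ => ?_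
  rw [Complex.real_smul, mul_comm]
  congr 1
  rw [dotProduct, ← Finset.sum_neg_distrib, Real.exp_sum, Complex.ofReal_prod]
  refine Finset.prod_congr rfl fun j _ => ?_
  rw [← Complex.ofReal_zpow, ← Real.rpow_intCast, ← Real.exp_mul, toReal]
  congr 2
  ring

lemma evalAt_exp_neg_mem {h : LaurentPoly n} (hh : h ≠ 0) {U : Set ℂ}
    (hU : IsOpenStronglyConvexCone U) (hmem : ∀ m ∈ exponents h, h.coeff m ∈ U)
    (u : Fin n → ℝ) : evalAt h (fun j => Real.exp (-u j)) ∈ U := by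
  rw [evalAt_exp_neg]
  set T := ∑ m ∈ exponents h, Real.exp (-(toReal m ⬝ᵥ u)) with hT
  have hT0 : 0 < T := Finset.sum_pos (fun m _ => Real.exp_pos _) (exponents_nonempty hh)
  have hsum : ∑ m ∈ exponents h, (Real.exp (-(toReal m ⬝ᵥ u)) / T) • h.coeff m ∈ U := by
    refine hU.convex.sum_mem (fun m _ => by positivity) ?_ hmem
    rw [← Finset.sum_div, div_self hT0.ne']
  have := hU.smul_mem hT0 hsum
  rw [Finset.smul_sum] at this
  convert this using 2 with m
  rw [smul_smul, mul_div_cancel₀ _ hT0.ne']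

/-- Since the coefficients lie in a common open half-plane, the terms of `h (exp (-u))` do not
cancel, and its size is that of its largest term. -/
lemma exists_abs_log_norm_evalAt_add_weight_le {h : LaurentPoly n} (hh : h ≠ 0) {U : Set ℂ}
    (hU : IsOpenStronglyConvexCone U) (hmem : ∀ m ∈ exponents h, h.coeff m ∈ U) :
    ∃ D : ℝ, ∀ u : Fin n → ℝ,
      |Real.log ‖evalAt h (fun j => Real.exp (-u j))‖ + weight u h| ≤ D := by
  obtain ⟨g, hg⟩ := hU.exists_pos
  obtain ⟨m₀, hm₀, hmin⟩ :=
    (exponents h).exists_min_image (fun m => g (h.coeff m)) (exponents_nonempty hh)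
  have hA : 0 < g (h.coeff m₀) := hg _ (hmem m₀ hm₀)
  have hg0 : 0 < ‖g‖ := norm_pos_iff.2 fun h0 => by simp [h0] at hA
  have hB : 0 < ∑ m ∈ exponents h, ‖h.coeff m‖ :=
    Finset.sum_pos (fun m hm => norm_pos_iff.2 (Finsupp.mem_support_iff.1 hm))
      (exponents_nonempty hh)
  set A := g (h.coeff m₀) / ‖g‖ with hAdef
  have hA' : 0 < A := by positivity
  set B := ∑ m ∈ exponents h, ‖h.coeff m‖ with hBdef
  refine ⟨max |Real.log A| |Real.log B|, fun u => ?_⟩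
  set z := evalAt h (fun j => Real.exp (-u j)) with hz
  have hupper : ‖z‖ ≤ B * Real.exp (-weight u h) := by
    rw [hz, evalAt_exp_neg, hBdef, Finset.sum_mul]
    refine norm_sum_le_of_le _ fun m hm => ?_
    rw [norm_smul, Real.norm_of_nonneg (Real.exp_pos _).le, mul_comm]
    gcongr
    exact weight_le hm u
  have hlower : A * Real.exp (-weight u h) ≤ ‖z‖ := by
    obtain ⟨m, hm, hmu⟩ := exists_eq_weight hh u
    rw [hAdef, div_mul_eq_mul_div, div_le_iff₀ hg0]
    calc g (h.coeff m₀) * Real.exp (-weight u h)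
        ≤ g (h.coeff m) * Real.exp (-weight u h) := by gcongr; exact hmin m hm
      _ = Real.exp (-(toReal m ⬝ᵥ u)) * g (h.coeff m) := by rw [hmu, mul_comm]
      _ ≤ ∑ m ∈ exponents h, Real.exp (-(toReal m ⬝ᵥ u)) * g (h.coeff m) :=
          Finset.single_le_sum (f := fun m => Real.exp (-(toReal m ⬝ᵥ u)) * g (h.coeff m))
            (fun m hm => mul_nonneg (Real.exp_pos _).le (hg _ (hmem m hm)).le) hm
      _ = g z := by rw [hz, evalAt_exp_neg]; simp only [map_sum, map_smul, smul_eq_mul]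
      _ ≤ ‖g z‖ := Real.le_norm_self _
      _ ≤ ‖z‖ * ‖g‖ := by rw [mul_comm]; exact g.le_opNorm z
  have hz0 : 0 < ‖z‖ := lt_of_lt_of_le (by positivity) hlower
  have h1 := Real.log_le_log hz0 hupper
  have h2 := Real.log_le_log (by positivity) hlower
  rw [Real.log_mul (by positivity) (Real.exp_pos _).ne', Real.log_exp] at h1 h2
  refine abs_le_max_abs_abs ?_ ?_ <;> linarith

/-! ### Convergence of the Mellin transform -/

/-- The Mellin integrand in the coordinates `t = exp (-u)`, with the Jacobian included. -/
noncomputable def logIntegrand (f : Fin k → LaurentPoly n) (L : Fin k → ℂ → ℂ) (s : Fin n → ℂ)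
    (c : Fin k → ℂ) (u : Fin n → ℝ) : ℂ :=
  Complex.exp (-∑ j, s j * u j - ∑ i, c i * L i (evalAt (f i) fun j => Real.exp (-u j)))

lemma det_pi_smul_proj (a : Fin n → ℝ) :
    (ContinuousLinearMap.pi fun j => a j • ContinuousLinearMap.proj (R := ℝ) (φ := fun _ => ℝ) j :
      (Fin n → ℝ) →L[ℝ] Fin n → ℝ).det = ∏ j, a j := by
  have h1 := LinearMap.det_pi (R := ℝ) (M := ℝ) fun j => a j • LinearMap.id
  have h2 : ∀ j, LinearMap.det (a j • LinearMap.id : ℝ →ₗ[ℝ] ℝ) = a j := fun j => by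
    rw [LinearMap.det_smul]; simp
  simp only [h2] at h1
  exact h1

lemma abs_det_smul_mellinIntegrand (f : Fin k → LaurentPoly n) (L : Fin k → ℂ → ℂ)
    (s : Fin n → ℂ) (c : Fin k → ℂ) (u : Fin n → ℝ) :
    |∏ j, -Real.exp (-u j)| • mellinIntegrand f L s c (fun j => Real.exp (-u j)) =
      logIntegrand f L s c u := by
  rw [Finset.abs_prod, Complex.real_smul, Complex.ofReal_prod, mellinIntegrand, logIntegrand,
    sub_eq_add_neg, Complex.exp_add, mul_comm, mul_assoc, ← Finset.prod_mul_distrib,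
    ← Finset.sum_neg_distrib, ← Finset.sum_neg_distrib, Complex.exp_sum, Complex.exp_sum]
  have h1 : ∀ j, ((Real.exp (-u j) : ℝ) : ℂ)⁻¹ * ((|-Real.exp (-u j)| : ℝ) : ℂ) = 1 := fun j => by
    rw [abs_neg, abs_of_pos (Real.exp_pos _)]
    exact inv_mul_cancel₀ (Complex.ofReal_ne_zero.2 (Real.exp_pos _).ne')
  have h2 : ∀ j, ((Real.exp (-u j) : ℝ) : ℂ) ^ s j = Complex.exp (-(s j * u j)) := fun j => by
    rw [Complex.cpow_def_of_ne_zero (Complex.ofReal_ne_zero.2 (Real.exp_pos _).ne'),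
      ← Complex.ofReal_log (Real.exp_pos _).le, Real.log_exp]
    congr 1; push_cast; ring
  simp only [h1, h2, Finset.prod_const_one, mul_one, neg_mul]

/-- The substitution `t = exp (-u)`. -/
lemma mellinConverges_iff_integrable_logIntegrand (f : Fin k → LaurentPoly n)
    (L : Fin k → ℂ → ℂ) (s : Fin n → ℂ) (c : Fin k → ℂ) :
    MellinConverges f L s c ↔ Integrable (logIntegrand f L s c) := by
  set Ψ : (Fin n → ℝ) → Fin n → ℝ := fun u j => Real.exp (-u j) with hΨ
  have himage : Ψ '' Set.univ = {t | ∀ j, 0 < t j} := by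
    ext t
    constructor
    · rintro ⟨u, -, rfl⟩ j
      exact Real.exp_pos _
    · intro ht
      exact ⟨fun j => -Real.log (t j), trivial, funext fun j => by
        simp [hΨ, Real.exp_log (ht j)]⟩
  have hinj : Set.InjOn Ψ Set.univ := fun u _ v _ huv => funext fun j => by
    simpa using Real.exp_injective (congrFun huv j)
  have hderiv : ∀ u ∈ Set.univ, HasFDerivWithinAt Ψ (ContinuousLinearMap.pi fun j =>
      (-Real.exp (-u j)) • ContinuousLinearMap.proj (R := ℝ) (φ := fun _ => ℝ) j)
      Set.univ u := by
    intro u _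
    refine HasFDerivAt.hasFDerivWithinAt (hasFDerivAt_pi.2 fun j => ?_)
    have h1 : HasFDerivAt (fun u : Fin n → ℝ => u j)
        (ContinuousLinearMap.proj (R := ℝ) (φ := fun _ => ℝ) j) u := hasFDerivAt_apply j u
    have h2 := h1.neg.exp
    rw [smul_neg, ← neg_smul] at h2
    exact h2
  rw [MellinConverges, ← himage, integrableOn_image_iff_integrableOn_abs_det_fderiv_smul volume
    MeasurableSet.univ hderiv hinj, integrableOn_univ]
  simp only [det_pi_smul_proj]
  exact iff_of_eq (congrArg (fun F => Integrable F volume)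
    (funext fun u => abs_det_smul_mellinIntegrand f L s c u))

variable {U : Fin k → Set ℂ} {L : Fin k → ℂ → ℂ}

lemma continuous_logIntegrand (hf : ∀ i, f i ≠ 0) (hU : ∀ i, IsOpenStronglyConvexCone (U i))
    (hfU : ∀ i, ∀ m ∈ exponents (f i), (f i).coeff m ∈ U i) (hL : ∀ i, IsLogBranch (L i) (U i))
    (s : Fin n → ℂ) (c : Fin k → ℂ) : Continuous (logIntegrand f L s c) := by
  unfold logIntegrand
  refine Complex.continuous_exp.comp (Continuous.sub (by fun_prop)
    (continuous_finsetSum _ fun i _ => continuous_const.mul ?_))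
  refine (hL i).1.comp_continuous ?_ (evalAt_exp_neg_mem (hf i) (hU i) (hfU i))
  simp only [evalAt_exp_neg]
  exact continuous_finsetSum _ fun m _ => by fun_prop

/-- Up to a bounded factor the integrand has the size `exp (-decay)`. -/
lemma exists_abs_log_norm_logIntegrand_add_decay_le (hf : ∀ i, f i ≠ 0)
    (hU : ∀ i, IsOpenStronglyConvexCone (U i))
    (hfU : ∀ i, ∀ m ∈ exponents (f i), (f i).coeff m ∈ U i) (hL : ∀ i, IsLogBranch (L i) (U i))
    (s : Fin n → ℂ) (c : Fin k → ℂ) :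
    ∃ M : ℝ, ∀ u : Fin n → ℝ, |Real.log ‖logIntegrand f L s c u‖ +
      decay f (fun j => (s j).re) (fun i => (c i).re) u| ≤ M := by
  choose C hC using fun i => (hU i).exists_abs_im_le (hL i)
  choose D hD using fun i => exists_abs_log_norm_evalAt_add_weight_le (hf i) (hU i) (hfU i)
  refine ⟨∑ i, (|(c i).im| * C i + |(c i).re| * D i), fun u => ?_⟩
  set z : Fin k → ℂ := fun i => evalAt (f i) fun j => Real.exp (-u j) with hz
  have hzU : ∀ i, z i ∈ U i := fun i => evalAt_exp_neg_mem (hf i) (hU i) (hfU i) u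
  have heq : Real.log ‖logIntegrand f L s c u‖ +
      decay f (fun j => (s j).re) (fun i => (c i).re) u =
      ∑ i, ((c i).im * (L i (z i)).im - (c i).re * (Real.log ‖z i‖ + weight u (f i))) := by
    rw [logIntegrand, Complex.norm_exp, Real.log_exp, decay]
    simp only [← (hL _).re_eq (hzU _)]
    simp only [Complex.sub_re, Complex.neg_re, Complex.re_sum, Complex.mul_re, Complex.ofReal_re,
      Complex.ofReal_im, mul_zero, sub_zero, dotProduct, mul_add, Finset.sum_sub_distrib,
      Finset.sum_add_distrib, hz]
    ring
  rw [heq]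
  refine (Finset.abs_sum_le_sum_abs _ _).trans (Finset.sum_le_sum fun i _ => ?_)
  refine (abs_sub _ _).trans ?_
  rw [abs_mul, abs_mul]
  gcongr
  · exact hC i _ (hzU i)
  · exact hD i u

/-- Absolute convergence means that the integrand decays in every direction. -/
theorem mellinConverges_iff_decay_pos (hf : ∀ i, f i ≠ 0)
    (hU : ∀ i, IsOpenStronglyConvexCone (U i))
    (hfU : ∀ i, ∀ m ∈ exponents (f i), (f i).coeff m ∈ U i) (hL : ∀ i, IsLogBranch (L i) (U i))
    (s : Fin n → ℂ) (c : Fin k → ℂ) :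
    MellinConverges f L s c ↔
      ∀ u : Fin n → ℝ, u ≠ 0 → 0 < decay f (fun j => (s j).re) (fun i => (c i).re) u := by
  set φ := decay f (fun j => (s j).re) (fun i => (c i).re) with hφ
  have hφc : Continuous φ := continuous_decay hf _ _
  have hGc := continuous_logIntegrand hf hU hfU hL s c
  rw [mellinConverges_iff_integrable_logIntegrand, ← integrable_exp_neg_iff volume hφc
    (fun r u hr => decay_smul hf _ _ hr u) (exists_decay_lipschitz hf _ _)]
  obtain ⟨M, hM⟩ := exists_abs_log_norm_logIntegrand_add_decay_le hf hU hfU hL s c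
  have hpos : ∀ u, 0 < ‖logIntegrand f L s c u‖ := fun u => norm_pos_iff.2 (Complex.exp_ne_zero _)
  constructor
  · intro hint
    refine (hint.norm.const_mul (Real.exp M)).mono' (by fun_prop)
      (Filter.Eventually.of_forall fun u => ?_)
    have h1 := (abs_le.1 (hM u)).1
    rw [Real.norm_of_nonneg (Real.exp_pos _).le, ← Real.exp_log (hpos u), ← Real.exp_add,
      Real.exp_le_exp]
    linarith
  · intro hint
    refine (hint.const_mul (Real.exp M)).mono' hGc.aestronglyMeasurable
      (Filter.Eventually.of_forall fun u => ?_)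
    have h1 := (abs_le.1 (hM u)).2
    rw [← Real.exp_log (hpos u), ← Real.exp_add, Real.exp_le_exp]
    linarith

end MellinTransform

theorem mainTheorem1 (n k : ℕ)
    (f : Fin k → MellinTransform.LaurentPoly n) (hf : ∀ i, f i ≠ 0)
    (U : Fin k → Set ℂ) (hU : ∀ i, MellinTransform.IsOpenStronglyConvexCone (U i))
    (hfU : ∀ i, ∀ m ∈ MellinTransform.exponents (f i), (f i).coeff m ∈ U i)
    (L : Fin k → ℂ → ℂ) (hL : ∀ i, MellinTransform.IsLogBranch (L i) (U i)) :
    (MellinTransform.IsFullDimensional (MellinTransform.newtonPolytope (∏ i, f i)) →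
      (MellinTransform.convergenceRegion f).Nonempty ∧
        ∀ (s : Fin n → ℂ) (c : Fin k → ℂ),
          MellinTransform.MellinConverges f L s c ↔
            (s, c) ∈ MellinTransform.convergenceRegion f) ∧
    (¬ MellinTransform.IsFullDimensional (MellinTransform.newtonPolytope (∏ i, f i)) →
      ∀ (s : Fin n → ℂ) (c : Fin k → ℂ), ¬ MellinTransform.MellinConverges f L s c) := by
  refine ⟨fun hfull => ⟨MellinTransform.convergenceRegion_nonempty hf hfull, fun s c => ?_⟩,
    fun hfull s c hconv => ?_⟩
  · rw [MellinTransform.mellinConverges_iff_decay_pos hf hU hfU hL,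
      MellinTransform.mem_convergenceRegion_iff hf hfull]
  · obtain ⟨u, hu, hle⟩ := MellinTransform.exists_decay_nonpos hf hfull
      (fun j => (s j).re) (fun i => (c i).re)
    exact hle.not_gt ((MellinTransform.mellinConverges_iff_decay_pos hf hU hfU hL s c).1 hconv u hu)
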